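/- **The calculus.** Fix a set of regions $r,s,\dots$; $e$ ranges over finite sets of regions. Terms (up to renaming of bound variables) and values are $$M::= x \mid r \mid * \mid \lambda x.M \mid MM \mid \mathsf{get}(M) \mid \mathsf{set}(M,M),\qquad V::= r\mid * \mid \lambda x.M .$$ Evaluation contexts are $E::=[\,]\mid EM\mid VE\mid \mathsf{get}(E)\mid \mathsf{set}(E,M)\mid\mathsf{set}(V,E)$. A store $S$ assigns to each region $r$ of a finite set $\mathrm{dom}(S)$ a (possibly infinite) set of values $S(r)$; $(r\Leftarrow v)$ is the store with domain $\{r\}$ and value $v$, and stores are merged by union, $(r\Leftarrow v_1),(r\Leftarrow v_2)=(r\Leftarrow v_1\cup v_2)$. A program is a multiset of terms (threads) and stores. Reduction is generated by $$E[(\lambda x.M)V]\to E[[V/x]M],\qquad E[\mathsf{get}(r)],(r\Leftarrow \{V\})\to E[V],(r\Leftarrow \{V\}),\qquad E[\mathsf{set}(r,V)]\to E[*],(r\Leftarrow \{V\}),$$ and $P,P''\to P',P''$ whenever $P\to P'$. A program terminates if all its reduction sequences are finite; $\mathrm{SN}$ is the set of programs $M,S$ with one thread that terminate, and $(M,S)\Downarrow(N,S')$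 means $M,S\to^*N,S'\not\to$. **Types.** $A::=\mathbf 1\mid \mathrm{Reg}_r A\mid (A\xrightarrow{e}A)$. Region contexts $R=r_1:A_1,\dots,r_n:A_n$ are ordered lists, with $\mathrm{dom}(R)=\{r_1,\dots,r_n\}$. The stratified well-formedness rules are: $\emptyset\vdash$; $R,r:A\vdash$ if $R\vdash A$ and $r\notin\mathrm{dom}(R)$; $R\vdash\mathbf 1$ if $R\vdash$; $R\vdash\mathrm{Reg}_rA$ if $R\vdash$ and $r:A\in R$; $R\vdash A\xrightarrow{e}B$ if $R\vdash A$, $R\vdash B$ and $e\subseteq\mathrm{dom}(R)$. For a context $\Gamma=x_1:B_1,\dots,x_m:B_m$, $R\vdash\Gamma$ means $R\vdash$ and $R\vdash B_i$ for all $i$. Subtyping: $R\vdash A\le A$ if $R\vdash A$; $R\vdash (A\xrightarrow{e}B)\le(A'\xrightarrow{e'}B')$ if $R\vdash A'\le A$, $R\vdash B\le B'$ and $e\subseteq e'\subseteq\mathrm{dom}(R)$; $R\vdash(A,e)\le(A',e')$ if $R\vdash A\le A'$ and $e\subseteq e'\subseteq\mathrm{dom}(R)$. The typing judgement $R;\Gamma\vdash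 M:(A,e)$ is defined by the rules - if $R\vdash\Gamma$, then $R;\Gamma\vdash x:(A,\emptyset)$ for $x:A\in\Gamma$, $R;\Gamma\vdash r:(\mathrm{Reg}_rA,\emptyset)$ for $r:A\in R$, and $R;\Gamma\vdash *:(\mathbf 1,\emptyset)$; - if $R;\Gamma,x:A\vdash M:(B,e)$, then $R;\Gamma\vdash\lambda x.M:(A\xrightarrow{e}B,\emptyset)$; - if $R;\Gamma\vdash M:(A\xrightarrow{e_2}B,e_1)$ and $R;\Gamma\vdash N:(A,e_3)$, then $R;\Gamma\vdash MN:(B,e_1\cup e_2\cup e_3)$; - if $R;\Gamma\vdash M:(\mathrm{Reg}_rA,e)$, then $R;\Gamma\vdash\mathsf{get}(M):(A,e\cup\{r\})$; - if $R;\Gamma\vdash M:(\mathrm{Reg}_rA,e_1)$ and $R;\Gamma\vdash N:(A,e_2)$, then $R;\Gamma\vdash\mathsf{set}(M,N):(\mathbf 1,e_1\cup e_2\cup\{r\})$; - if $R;\Gamma\vdash M:(A,e)$ and $R\vdash(A,e)\le(A',e')$, then $R;\Gamma\vdash M:(A',e')$. A multi-threaded program satisfies $R;\Gamma\vdash M_1,\dots,M_n:(\mathbf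 B,e_1\cup\dots\cup e_n)$, $n\ge1$, where $\mathbf B$ is a constant behaviour type, if $R;\Gamma\vdash M_i:(A_i,e_i)$ for some types $A_i$, $i=1,\dots,n$. **Interpretation.** Write $R'\ge R$ if $R'\vdash$ and $R'=R,R''$ for some $R''$. For $R=r_1:A_1,\dots,r_n:A_n$ and $R'\ge R$, $[\![R]\!](R')$ is the saturated store with domain $\mathrm{dom}(R)$ and $$[\![R]\!](R')(r_i)=\{V\mid R'\vdash V\in[\![\,r_1:A_1,\dots,r_{i-1}:A_{i-1}\vdash(A_i,\emptyset)]\!]\}.$$ $[\![R\vdash(A,e)]\!]$ is the set of pairs $R'\vdash M$ such that (1) $R'\ge R$ and $R';\emptyset\vdash M:(A,e)$; (2) $M,[\![R]\!](R'')\in\mathrm{SN}$ for all $R''\ge R'$; (3) for all $R''\ge R'$, $M'$, $S'$, if $(M,[\![R]\!](R''))\Downarrow(M',S')$ then $S'=[\![R]\!](R'')$ and: if $A=\mathbf 1$ then $M'=*$; if $A=\mathrm{Reg}_rB$ then $M'=r$; if $A=A_1\xrightarrow{e'}A_2$ then $M'=\lambda x.N$ for some $N$ and, for all $R_1\ge R''$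 and all values $V$, $R_1\vdash V\in[\![R\vdash(A_1,\emptyset)]\!]$ implies $R_1\vdash M'V\in[\![R\vdash(A_2,e')]\!]$. **Corollary (termination).** (1) For all $R,M,A,e$, the judgement $R;\emptyset\vdash M:(A,e)$ is derivable if and only if $R\vdash M\in[\![R\vdash(A,e)]\!]$. (2) Every typable multi-threaded program $R;\emptyset\vdash M_1,\dots,M_n:(\mathbf B,e)$ terminates. -/

import Mathlib

namespace RegionCalculus

universe u

section Terms

variable {Reg : Type u}

/-- Types `A ::= 1 | Reg_r A | (A -e-> A)`, where `e` is a finite set of regions. -/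
inductive Ty (Reg : Type u) : Type u
  | unit : Ty Reg
  | reg (r : Reg) (A : Ty Reg) : Ty Reg
  | arr (A : Ty Reg) (e : Finset Reg) (B : Ty Reg) : Ty Reg

/-- Terms `M ::= x | r | * | λx.M | M M | get(M) | set(M,M)`, up to renaming of bound variables:
variables are de Bruijn indices. -/
inductive Tm (Reg : Type u) : Type u
  | var (x : ℕ) : Tm Reg
  | reg (r : Reg) : Tm Reg
  | star : Tm Reg
  | lam (M : Tm Reg) : Tm Reg
  | app (M N : Tm Reg) : Tm Reg
  | get (M : Tm Reg) : Tm Reg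
  | set (M N : Tm Reg) : Tm Reg

/-- Extend a renaming under a binder. -/
def upRen (ρ : ℕ → ℕ) : ℕ → ℕ
  | 0 => 0
  | x + 1 => ρ x + 1

/-- Renaming of variables. -/
def Tm.rename : (ℕ → ℕ) → Tm Reg → Tm Reg
  | ρ, .var x => .var (ρ x)
  | _, .reg r => .reg r
  | _, .star => .star
  | ρ, .lam M => .lam (M.rename (upRen ρ))
  | ρ, .app M N => .app (M.rename ρ) (N.rename ρ)
  | ρ, .get M => .get (M.rename ρ)
  | ρ, .set M N => .set (M.rename ρ) (N.rename ρ)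

/-- Extend a substitution under a binder. -/
def upSubst (σ : ℕ → Tm Reg) : ℕ → Tm Reg
  | 0 => .var 0
  | x + 1 => (σ x).rename Nat.succ

/-- Capture-avoiding simultaneous substitution. -/
def Tm.subst : (ℕ → Tm Reg) → Tm Reg → Tm Reg
  | σ, .var x => σ x
  | _, .reg r => .reg r
  | _, .star => .star
  | σ, .lam M => .lam (M.subst (upSubst σ))
  | σ, .app M N => .app (M.subst σ) (N.subst σ)
  | σ, .get M => .get (M.subst σ)
  | σ, .set M N => .set (M.subst σ) (N.subst σ)

/-- The substitution sending the variable `0` to `N` and lowering the others. -/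
def single (N : Tm Reg) : ℕ → Tm Reg
  | 0 => N
  | x + 1 => .var x

/-- `M.inst N` is `[N/x]M`, where `x` is the variable bound in `λx.M`. -/
def Tm.inst (M N : Tm Reg) : Tm Reg := M.subst (single N)

/-- The values `V ::= r | * | λx.M` among the terms. -/
inductive Tm.IsValue : Tm Reg → Prop
  | reg (r : Reg) : Tm.IsValue (.reg r)
  | star : Tm.IsValue .star
  | lam (M : Tm Reg) : Tm.IsValue (.lam M)

/-- The type of values. -/
abbrev Val (Reg : Type u) : Type u := {M : Tm Reg // M.IsValue}

/-- Call-by-value evaluation contexts `E ::= [] | E M | V E | get(E) | set(E,M) | set(V,E)`. -/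
inductive ECtx (Reg : Type u) : Type u
  | hole : ECtx Reg
  | appL (E : ECtx Reg) (M : Tm Reg) : ECtx Reg
  | appR (V : Val Reg) (E : ECtx Reg) : ECtx Reg
  | get (E : ECtx Reg) : ECtx Reg
  | setL (E : ECtx Reg) (M : Tm Reg) : ECtx Reg
  | setR (V : Val Reg) (E : ECtx Reg) : ECtx Reg

/-- `E.plug M` is `E[M]`. -/
def ECtx.plug : ECtx Reg → Tm Reg → Tm Reg
  | .hole, M => M
  | .appL E N, M => .app (E.plug M) N
  | .appR V E, M => .app V.1 (E.plug M)
  | .get E, M => .get (E.plug M)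
  | .setL E N, M => .set (E.plug M) N
  | .setR V E, M => .set V.1 (E.plug M)

end Terms

section Programs

variable {Reg : Type u}

/-- Stores, up to the identification of `r ⇐ v₁, r ⇐ v₂` with `r ⇐ v₁ ∪ v₂`: a finite set of
regions, and for each of them a (possibly infinite) set of values. -/
@[ext]
structure Store (Reg : Type u) : Type u where
  dom : Finset Reg
  val : Reg → Set (Val Reg)
  val_eq_empty : ∀ r, r ∉ dom → val r = ∅

/-- No store at all. -/
def Store.empty : Store Reg where
  dom := ∅
  val _ := ∅
  val_eq_empty _ _ := rfl

/-- The store `r ⇐ v`. -/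
def Store.cell (r : Reg) (v : Set (Val Reg)) : Store Reg where
  dom := {r}
  val s := {V | s = r ∧ V ∈ v}
  val_eq_empty s hs := by
    ext V
    simp only [Finset.mem_singleton] at hs
    simp [hs]

/-- The store `S, T`. -/
def Store.union [DecidableEq Reg] (S T : Store Reg) : Store Reg where
  dom := S.dom ∪ T.dom
  val r := S.val r ∪ T.val r
  val_eq_empty r hr := by
    simp only [Finset.mem_union, not_or] at hr
    simp [S.val_eq_empty r hr.1, T.val_eq_empty r hr.2]

/-- Programs: multisets of terms (threads) and stores, the stores being merged into one. -/
@[ext]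
structure Prog (Reg : Type u) : Type u where
  threads : Multiset (Tm Reg)
  store : Store Reg

/-- The program consisting of the single thread `M` and the store `S`. -/
def Prog.single (M : Tm Reg) (S : Store Reg) : Prog Reg := ⟨{M}, S⟩

/-- The multi-threaded program `M₁, …, Mₙ`, without a store. -/
def Prog.ofThreads (Ms : Multiset (Tm Reg)) : Prog Reg := ⟨Ms, Store.empty⟩

/-- The term `M` as a program. -/
def Prog.thread (M : Tm Reg) : Prog Reg := Prog.single M Store.empty

/-- The store `r ⇐ v` as a program. -/
def Prog.cell (r : Reg) (v : Set (Val Reg)) : Prog Reg := ⟨0, Store.cell r v⟩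

variable [DecidableEq Reg]

/-- The program `P, Q`. -/
def Prog.par (P Q : Prog Reg) : Prog Reg := ⟨P.threads + Q.threads, P.store.union Q.store⟩

/-- Reduction of programs. -/
inductive Red : Prog Reg → Prog Reg → Prop
  | beta (E : ECtx Reg) (M : Tm Reg) (V : Val Reg) :
      Red (Prog.thread (E.plug (.app (.lam M) V.1))) (Prog.thread (E.plug (M.inst V.1)))
  | get (E : ECtx Reg) (r : Reg) (V : Val Reg) :
      Red ((Prog.thread (E.plug (.get (.reg r)))).par (Prog.cell r {V}))
        ((Prog.thread (E.plug V.1)).par (Prog.cell r {V}))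
  | set (E : ECtx Reg) (r : Reg) (V : Val Reg) :
      Red (Prog.thread (E.plug (.set (.reg r) V.1)))
        ((Prog.thread (E.plug .star)).par (Prog.cell r {V}))
  | par {P P' : Prog Reg} (Q : Prog Reg) : Red P P' → Red (P.par Q) (P'.par Q)

/-- All reduction sequences starting from `P` terminate. -/
def Terminates (P : Prog Reg) : Prop :=
  ¬ ∃ f : ℕ → Prog Reg, f 0 = P ∧ ∀ n, Red (f n) (f (n + 1))

/-- `M, S ∈ SN`: the single-threaded program `M, S` is strongly normalising. -/
def SN (M : Tm Reg) (S : Store Reg) : Prop := Terminates (Prog.single M S)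

/-- `(M, S) ⇓ (N, S')`: `M, S` reduces in some number of steps to `N, S'`, which is irreducible. -/
def Conv (M : Tm Reg) (S : Store Reg) (N : Tm Reg) (S' : Store Reg) : Prop :=
  Relation.ReflTransGen Red (Prog.single M S) (Prog.single N S') ∧
    ∀ P, ¬ Red (Prog.single N S') P

end Programs

section Typing

variable {Reg : Type u}

/-- Region contexts. They are ordered and grow at the head of the list:
`R, r:A` is `(r, A) :: R`, and `r₁:A₁, …, rₙ:Aₙ` is `[(rₙ, Aₙ), …, (r₁, A₁)]`. -/
abbrev RCtx (Reg : Type u) : Type u := List (Reg × Ty Reg)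

variable [DecidableEq Reg]

/-- The domain of a region context. -/
def RCtx.dom (R : RCtx Reg) : Finset Reg := (R.map Prod.fst).toFinset

mutual

/-- `R ⊢`: (stratified) well-formed region contexts. -/
inductive RCtx.WF : RCtx Reg → Prop
  | nil : RCtx.WF []
  | cons {R : RCtx Reg} {r : Reg} {A : Ty Reg} :
      Ty.WF R A → r ∉ RCtx.dom R → RCtx.WF ((r, A) :: R)

/-- `R ⊢ A`: (stratified) well-formed types. -/
inductive Ty.WF : RCtx Reg → Ty Reg → Prop
  | unit {R : RCtx Reg} : RCtx.WF R → Ty.WF R .unit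
  | reg {R : RCtx Reg} {r : Reg} {A : Ty Reg} :
      RCtx.WF R → (r, A) ∈ R → Ty.WF R (.reg r A)
  | arr {R : RCtx Reg} {A B : Ty Reg} {e : Finset Reg} :
      Ty.WF R A → Ty.WF R B → e ⊆ RCtx.dom R → Ty.WF R (.arr A e B)

end

/-- `R ⊢ A ≤ B`: subtyping. -/
inductive Sub (R : RCtx Reg) : Ty Reg → Ty Reg → Prop
  | refl {A : Ty Reg} : Ty.WF R A → Sub R A A
  | arr {A A' B B' : Ty Reg} {e e' : Finset Reg} :
      Sub R A' A → Sub R B B' → e ⊆ e' → e' ⊆ RCtx.dom R →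
        Sub R (.arr A e B) (.arr A' e' B')

/-- `R ⊢ (A, e) ≤ (A', e')`: subtyping of types and effects. -/
def SubEff (R : RCtx Reg) (A : Ty Reg) (e : Finset Reg) (A' : Ty Reg) (e' : Finset Reg) : Prop :=
  Sub R A A' ∧ e ⊆ e' ∧ e' ⊆ RCtx.dom R

/-- `R ⊢ Γ`: well-formed contexts. The variable `x` has the type at position `x` of `Γ`. -/
def CtxWF (R : RCtx Reg) (Γ : List (Ty Reg)) : Prop :=
  RCtx.WF R ∧ ∀ A ∈ Γ, Ty.WF R A

/-- `R; Γ ⊢ M : (A, e)`: typing of terms in the stratified type and effect system. -/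
inductive HasType (R : RCtx Reg) : List (Ty Reg) → Tm Reg → Ty Reg → Finset Reg → Prop
  | var {Γ : List (Ty Reg)} {x : ℕ} {A : Ty Reg} :
      CtxWF R Γ → Γ[x]? = some A → HasType R Γ (.var x) A ∅
  | reg {Γ : List (Ty Reg)} {r : Reg} {A : Ty Reg} :
      CtxWF R Γ → (r, A) ∈ R → HasType R Γ (.reg r) (.reg r A) ∅
  | star {Γ : List (Ty Reg)} :
      CtxWF R Γ → HasType R Γ .star .unit ∅
  | lam {Γ : List (Ty Reg)} {M : Tm Reg} {A B : Ty Reg} {e : Finset Reg} :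
      HasType R (A :: Γ) M B e → HasType R Γ (.lam M) (.arr A e B) ∅
  | app {Γ : List (Ty Reg)} {M N : Tm Reg} {A B : Ty Reg} {e₁ e₂ e₃ : Finset Reg} :
      HasType R Γ M (.arr A e₂ B) e₁ → HasType R Γ N A e₃ →
        HasType R Γ (.app M N) B (e₁ ∪ e₂ ∪ e₃)
  | get {Γ : List (Ty Reg)} {M : Tm Reg} {r : Reg} {A : Ty Reg} {e : Finset Reg} :
      HasType R Γ M (.reg r A) e → HasType R Γ (.get M) A (e ∪ {r})
  | set {Γ : List (Ty Reg)} {M N : Tm Reg} {r : Reg} {A : Ty Reg} {e₁ e₂ : Finset Reg} :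
      HasType R Γ M (.reg r A) e₁ → HasType R Γ N A e₂ →
        HasType R Γ (.set M N) .unit (e₁ ∪ e₂ ∪ {r})
  | sub {Γ : List (Ty Reg)} {M : Tm Reg} {A A' : Ty Reg} {e e' : Finset Reg} :
      HasType R Γ M A e → SubEff R A e A' e' → HasType R Γ M A' e'

/-- `R; Γ ⊢ P : (𝐁, e)`: typing of multi-threaded programs with the behaviour type `𝐁`.
The rule for `X₁, …, Xₙ` with `n ≥ 1` is given in binary form; a single term of type and effect
`(A, e)` also has, by the case `n = 1`, the behaviour `(𝐁, e)`. -/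
inductive ProgHasType (R : RCtx Reg) (Γ : List (Ty Reg)) : Prog Reg → Finset Reg → Prop
  | thread {M : Tm Reg} {A : Ty Reg} {e : Finset Reg} :
      HasType R Γ M A e → ProgHasType R Γ (Prog.thread M) e
  | cell {r : Reg} {A : Ty Reg} {v : Set (Val Reg)} :
      (r, A) ∈ R → (∀ V ∈ v, HasType R Γ V.1 A ∅) → ProgHasType R Γ (Prog.cell r v) ∅
  | par {P Q : Prog Reg} {e₁ e₂ : Finset Reg} :
      ProgHasType R Γ P e₁ → ProgHasType R Γ Q e₂ → ProgHasType R Γ (P.par Q) (e₁ ∪ e₂)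

end Typing

section Interpretation

variable {Reg : Type u} [DecidableEq Reg]

/-- `R' ≥ R`: `R' ⊢` and `R' = R, R''` for some `R''`. -/
def Extends (R' R : RCtx Reg) : Prop := RCtx.WF R' ∧ R <:+ R'

/-- The clauses (1), (2), (3) defining `R' ⊢ M ∈ ⟦R ⊢ (A, e)⟧`, in terms of the saturated stores
`sat R'' = ⟦R⟧(R'')` and of the predicate `C R'' M'` imposed on the normal forms. -/
def Reducible (R : RCtx Reg) (sat : RCtx Reg → Store Reg) (C : RCtx Reg → Tm Reg → Prop)
    (A : Ty Reg) (e : Finset Reg) (R' : RCtx Reg) (M : Tm Reg) : Prop :=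
  (Extends R' R ∧ HasType R' [] M A e) ∧
  (∀ R'', Extends R'' R' → SN M (sat R'')) ∧
  (∀ M' S' R'', Extends R'' R' → Conv M (sat R'') M' S' → S' = sat R'' ∧ C R'' M')

/-- The predicate `C(A, R, R'', M')` on normal forms, in terms of the saturated stores
`sat R'' = ⟦R⟧(R'')`. -/
def CPred (R : RCtx Reg) (sat : RCtx Reg → Store Reg) : Ty Reg → RCtx Reg → Tm Reg → Prop
  | .unit, _, M' => M' = .star
  | .reg r _, _, M' => M' = .reg r
  | .arr A₁ e' A₂, R'', M' =>
      (∃ N, M' = .lam N) ∧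
      ∀ (R₁ : RCtx Reg) (V : Val Reg), Extends R₁ R'' →
        Reducible R sat (CPred R sat A₁) A₁ ∅ R₁ V.1 →
        Reducible R sat (CPred R sat A₂) A₂ e' R₁ (.app M' V.1)

/-- The saturated store `⟦R⟧(R')`: its domain is that of `R`, and if `R = R₁, r:A, R₂` it contains
in the region `r` the values `V` with `R' ⊢ V ∈ ⟦R₁ ⊢ (A, ∅)⟧`. -/
def satStore : RCtx Reg → RCtx Reg → Store Reg
  | [], _ => Store.empty
  | (r, A) :: R, R' =>
      (satStore R R').union
        (Store.cell r {V | Reducible R (satStore R) (CPred R (satStore R) A) A ∅ R' V.1})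

/-- `⟦R ⊢ (A, e)⟧`, a set of pairs `R' ⊢ M`. -/
def sem (R : RCtx Reg) (A : Ty Reg) (e : Finset Reg) : Set (RCtx Reg × Tm Reg) :=
  {p | Reducible R (satStore R) (CPred R (satStore R) A) A e p.1 p.2}

/-- `⟦R⟧`, a set of pairs `R' ⊢ S`. -/
def semCtx (R : RCtx Reg) : Set (RCtx Reg × Store Reg) :=
  {p | Extends p.1 R ∧ p.2.dom = RCtx.dom R ∧
    ∀ (R₁ : RCtx Reg) (r : Reg) (A : Ty Reg), (r, A) :: R₁ <:+ R →
      p.2.val r = {V | (p.1, V.1) ∈ sem R₁ A ∅}}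

/-- The interpretation satisfies its defining equation, with `satStore R` for `⟦R⟧`. -/
theorem mem_sem_iff (R R' : RCtx Reg) (A : Ty Reg) (e : Finset Reg) (M : Tm Reg) :
    (R', M) ∈ sem R A e ↔
      (Extends R' R ∧ HasType R' [] M A e) ∧
      (∀ R'', Extends R'' R' → SN M (satStore R R'')) ∧
      (∀ M' S' R'', Extends R'' R' → Conv M (satStore R R'') M' S' →
        S' = satStore R R'' ∧
        (A = .unit → M' = .star) ∧
        (∀ r B, A = .reg r B → M' = .reg r) ∧
        (∀ A₁ e' A₂, A = .arr A₁ e' A₂ → (∃ N, M' = .lam N) ∧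
          ∀ (R₁ : RCtx Reg) (V : Val Reg), Extends R₁ R'' → (R₁, V.1) ∈ sem R A₁ ∅ →
            (R₁, .app M' V.1) ∈ sem R A₂ e')) := by
  cases A <;> simp [sem, Reducible, CPred]

theorem satStore_dom (R R' : RCtx Reg) : (satStore R R').dom = RCtx.dom R := by
  induction R with
  | nil => rfl
  | cons p R ih =>
    obtain ⟨r, A⟩ := p
    simp [satStore, Store.union, Store.cell, ih, RCtx.dom, Finset.union_comm]

theorem RCtx.WF.tail {R : RCtx Reg} {r : Reg} {A : Ty Reg} :
    RCtx.WF ((r, A) :: R) → Ty.WF R A ∧ r ∉ RCtx.dom R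
  | .cons h₁ h₂ => ⟨h₁, h₂⟩

theorem Ty.WF.rctx {R : RCtx Reg} {A : Ty Reg} (h : Ty.WF R A) : RCtx.WF R := by
  induction A with
  | unit => cases h; assumption
  | reg r A ih => cases h; assumption
  | arr A e B ih₁ ih₂ => cases h with | arr h₁ h₂ h₃ => exact ih₁ h₁

theorem Extends.wf_of_wf {R R' : RCtx Reg} (h : RCtx.WF R') (hs : R <:+ R') : RCtx.WF R := by
  induction R' with
  | nil => simp_all
  | cons p R' ih =>
    rcases List.suffix_cons_iff.1 hs with rfl | hs
    · exact h
    · exact ih (RCtx.WF.tail h).1.rctx hs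

/-- For `R' ≥ R`, `⟦R⟧(R')` is the store `S` such that `R' ⊢ S ∈ ⟦R⟧`. -/
theorem mem_semCtx_iff {R R' : RCtx Reg} (h : Extends R' R) (S : Store Reg) :
    (R', S) ∈ semCtx R ↔ S = satStore R R' := by
  have key : ∀ R : RCtx Reg, RCtx.WF R → ∀ (R₁ : RCtx Reg) (r : Reg) (A : Ty Reg),
      (r, A) :: R₁ <:+ R → (satStore R R').val r = {V | (R', V.1) ∈ sem R₁ A ∅} := by
    intro R hR R₁ r A hs
    induction R with
    | nil => simp at hs
    | cons p R ih =>
      obtain ⟨s, B⟩ := p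
      obtain ⟨hB, hs'⟩ := RCtx.WF.tail hR
      rcases List.suffix_cons_iff.1 hs with heq | hs2
      · obtain ⟨⟨rfl, rfl⟩, rfl⟩ : (r = s ∧ A = B) ∧ R₁ = R := by simpa using heq
        have h0 := (satStore R₁ R').val_eq_empty r (by rwa [satStore_dom])
        simp [satStore, Store.union, Store.cell, h0, sem]
      · have hne : r ≠ s := by
          rintro rfl
          apply hs'
          have : (r, A) ∈ R := hs2.subset List.mem_cons_self
          simp only [RCtx.dom, List.mem_toFinset, List.mem_map]
          exact ⟨_, this, rfl⟩
        rw [← ih hB.rctx hs2]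
        simp [satStore, Store.union, Store.cell, hne]
  have hR : RCtx.WF R := Extends.wf_of_wf h.1 h.2
  constructor
  · rintro ⟨-, hd, hv⟩
    apply Store.ext
    · rw [satStore_dom]; exact hd
    · funext r
      by_cases hr : r ∈ RCtx.dom R
      · simp only [RCtx.dom, List.mem_toFinset, List.mem_map] at hr
        obtain ⟨⟨s, A⟩, hm, rfl⟩ := hr
        obtain ⟨R₂, R₁, rfl⟩ := List.append_of_mem hm
        have hs : (s, A) :: R₁ <:+ R₂ ++ (s, A) :: R₁ := List.suffix_append _ _
        rw [key _ hR R₁ s A hs]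
        exact hv R₁ s A hs
      · rw [S.val_eq_empty r (by rw [show S.dom = _ from hd]; exact hr),
          (satStore R R').val_eq_empty r (by rwa [satStore_dom])]
  · rintro rfl
    exact ⟨h, satStore_dom R R', fun R₁ r A hs => key R hR R₁ r A hs⟩

end Interpretation

end RegionCalculus

open RegionCalculus

/-!
Termination is proved by reducibility. The point of the stratification is that the saturated store
`satStore R R'` is a fixed point of evaluation: everything that a well-typed term may ever write
into it is already there. So evaluation in this store can be described without mentioning stores
that change: `Safe S C M` says inductively that every step of `M` enabled in `S` leaves `S` as it is
and leads to a safe term, and that `M` satisfies `C` if it is stuck. As stores only grow, this is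
what clauses (2) and (3) of the interpretation say (`safe_iff`), and evaluation under a frame is
handled by one induction on `Safe` (`Safe.bind`). To this end reduction of programs is replaced by
thread steps labelled with their action on the store (`red_iff`).

A region `r : A` of `R` contains, in `satStore R R'`, the values that are reducible for `A` over the
part of `R` that precedes `r`, whereas reading and writing produce and consume values reducible for
`A` over the whole of `R`. That these are the same (`sem_restrict`) follows from subject reduction
with effects: a term only touches the regions in its effect (`HasType.regions_subset`,
`HasType.lStep`), so that its evaluation depends on these regions only (`Safe.transfer`).

The soundness of the typing rules (`HasType.subst_mem_sem`) is then proved by induction on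
derivations. For `get` it has to be known that `get r` is not stuck, that is, that each region of the
saturated store contains a value; this holds because every well-formed type has a reducible closed
value (`Ty.WF.inhabitant_mem_sem`).

For several threads, all are safe for the one store `satStore R R`, and a store below it remains
below it. Each step replaces one thread of the multiset by a smaller one in a well-founded relation,
and there is no infinite sequence of such replacements (`terminates_of_safe`).
-/

namespace RegionCalculus

universe u

/-! ### Labelled thread reduction -/

section Operational

variable {Reg : Type u}

/-- What a single reduction step of a thread asks of the store: nothing, the presence of a value
in a region, or the addition of a value to a region. -/
inductive Act (Reg : Type u) : Type u
  | tau : Act Reg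
  | read (r : Reg) (V : Val Reg) : Act Reg
  | write (r : Reg) (V : Val Reg) : Act Reg

/-- The action can take place in the store `S`. -/
def Act.Enabled (S : Store Reg) : Act Reg → Prop
  | .read r V => V ∈ S.val r
  | _ => True

/-- The regions that an action touches. -/
def Act.regions : Act Reg → Finset Reg
  | .tau => ∅
  | .read r _ => {r}
  | .write r _ => {r}

/-- A thread step labelled by its action on the store. Evaluation contexts are replaced by
congruence rules. -/
inductive LStep : Tm Reg → Act Reg → Tm Reg → Prop
  | beta (M : Tm Reg) {V : Tm Reg} : V.IsValue → LStep (.app (.lam M) V) .tau (M.inst V)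
  | read (r : Reg) (V : Val Reg) : LStep (.get (.reg r)) (.read r V) V.1
  | write (r : Reg) {V : Tm Reg} (hV : V.IsValue) :
      LStep (.set (.reg r) V) (.write r ⟨V, hV⟩) .star
  | appL {M M' : Tm Reg} {a : Act Reg} (N : Tm Reg) :
      LStep M a M' → LStep (.app M N) a (.app M' N)
  | appR {V N N' : Tm Reg} {a : Act Reg} :
      V.IsValue → LStep N a N' → LStep (.app V N) a (.app V N')
  | get {M M' : Tm Reg} {a : Act Reg} : LStep M a M' → LStep (.get M) a (.get M')
  | setL {M M' : Tm Reg} {a : Act Reg} (N : Tm Reg) :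
      LStep M a M' → LStep (.set M N) a (.set M' N)
  | setR {V N N' : Tm Reg} {a : Act Reg} :
      V.IsValue → LStep N a N' → LStep (.set V N) a (.set V N')

theorem Tm.IsValue.not_lStep {V M : Tm Reg} {a : Act Reg} (hV : V.IsValue) : ¬ LStep V a M := by
  intro h
  cases hV <;> cases h

theorem LStep.plug (E : ECtx Reg) {M M' : Tm Reg} {a : Act Reg} (h : LStep M a M') :
    LStep (E.plug M) a (E.plug M') := by
  induction E with
  | hole => exact h
  | appL E N ih => exact .appL N ih
  | appR V E ih => exact .appR V.2 ih
  | get E ih => exact .get ih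
  | setL E N ih => exact .setL N ih
  | setR V E ih => exact .setR V.2 ih

/-- A one-hole term context whose hole is evaluated first: as long as the hole is not filled with
a value, the steps of the whole are exactly those of the term in the hole. -/
structure IsFrame (F : Tm Reg → Tm Reg) : Prop where
  lift {M M' : Tm Reg} {a : Act Reg} : LStep M a M' → LStep (F M) a (F M')
  inv {M N : Tm Reg} {a : Act Reg} : ¬ M.IsValue → LStep (F M) a N →
    ∃ M', LStep M a M' ∧ N = F M'

theorem isFrame_appL (N : Tm Reg) : IsFrame (fun M => Tm.app M N) where
  lift h := .appL N h
  inv hM h := by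
    cases h with
    | beta M hV => exact absurd (.lam M) hM
    | appL _ h => exact ⟨_, h, rfl⟩
    | appR hV _ => exact absurd hV hM

theorem isFrame_appR {V : Tm Reg} (hV : V.IsValue) : IsFrame (fun M => Tm.app V M) where
  lift h := .appR hV h
  inv hM h := by
    cases h with
    | beta M hV => exact absurd hV hM
    | appL _ h => exact absurd h hV.not_lStep
    | appR _ h => exact ⟨_, h, rfl⟩

theorem isFrame_get : IsFrame (Tm.get : Tm Reg → Tm Reg) where
  lift h := .get h
  inv hM h := by
    cases h with
    | read r V => exact absurd (.reg r) hM
    | get h => exact ⟨_, h, rfl⟩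

theorem isFrame_setL (N : Tm Reg) : IsFrame (fun M => Tm.set M N) where
  lift h := .setL N h
  inv hM h := by
    cases h with
    | write r hV => exact absurd (.reg r) hM
    | setL _ h => exact ⟨_, h, rfl⟩
    | setR hV _ => exact absurd hV hM

theorem isFrame_setR {V : Tm Reg} (hV : V.IsValue) : IsFrame (fun M => Tm.set V M) where
  lift h := .setR hV h
  inv hM h := by
    cases h with
    | write r hV => exact absurd hV hM
    | setL _ h => exact absurd h hV.not_lStep
    | setR _ h => exact ⟨_, h, rfl⟩

/-! ### Program reduction in terms of thread steps -/

variable [DecidableEq Reg]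

/-- The store after an action. -/
def Store.update (S : Store Reg) : Act Reg → Store Reg
  | .write r V => S.union (Store.cell r {V})
  | _ => S

theorem Store.mem_dom {S : Store Reg} {r : Reg} {V : Val Reg} (h : V ∈ S.val r) : r ∈ S.dom := by
  by_contra hr
  simp [S.val_eq_empty r hr] at h

theorem Store.union_assoc (S T U : Store Reg) : (S.union T).union U = S.union (T.union U) := by
  ext <;> simp [Store.union, or_assoc]

theorem Store.union_comm (S T : Store Reg) : S.union T = T.union S := by
  ext <;> simp [Store.union, or_comm]

theorem Store.union_empty (S : Store Reg) : S.union Store.empty = S := by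
  ext <;> simp [Store.union, Store.empty]

theorem Store.empty_union (S : Store Reg) : Store.empty.union S = S := by
  rw [Store.union_comm, Store.union_empty]

theorem Store.union_cell_eq_self {S : Store Reg} {r : Reg} {V : Val Reg} :
    S.union (Store.cell r {V}) = S ↔ V ∈ S.val r := by
  constructor
  · intro h
    rw [← h]
    simp [Store.union, Store.cell]
  · intro h
    have hr := Store.mem_dom h
    ext s W
    · simp only [Store.union, Store.cell, Finset.mem_union, Finset.mem_singleton]
      grind
    · simp only [Store.union, Store.cell, Set.mem_union, Set.mem_singleton_iff, Set.mem_ofPred_eq]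
      grind

/-- A program reduces by choosing a thread and performing one of its enabled steps. -/
theorem red_iff {P P' : Prog Reg} :
    Red P P' ↔ ∃ M Ts a M', P.threads = M ::ₘ Ts ∧ LStep M a M' ∧ a.Enabled P.store ∧
      P' = ⟨M' ::ₘ Ts, P.store.update a⟩ := by
  constructor
  · intro h
    induction h with
    | beta E M V =>
      exact ⟨_, 0, .tau, _, rfl, .plug E (.beta M V.2), trivial, rfl⟩
    | get E r V =>
      refine ⟨_, 0, .read r V, _, rfl, .plug E (.read r V), ?_, rfl⟩
      simp [Act.Enabled, Prog.par, Prog.cell, Store.union, Store.cell]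
    | set E r V =>
      exact ⟨_, 0, .write r V, _, rfl, .plug E (.write r V.2), trivial, rfl⟩
    | @par P P' Q h ih =>
      obtain ⟨M, Ts, a, M', hT, hs, ha, rfl⟩ := ih
      refine ⟨M, Ts + Q.threads, a, M', ?_, hs, ?_, ?_⟩
      · simp [Prog.par, hT]
      · cases a with
        | read r V => exact Or.inl ha
        | _ => trivial
      · cases a <;> simp only [Prog.par, Store.update, Multiset.cons_add]
        congr 1
        rw [Store.union_assoc, Store.union_assoc, Store.union_comm Q.store]
  · rintro ⟨M, Ts, a, M', hT, hs, ha, rfl⟩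
    obtain ⟨T, S⟩ := P
    obtain rfl : T = M ::ₘ Ts := hT
    -- Every labelled step takes place at a redex in an evaluation context.
    have key : (∃ E N V, a = .tau ∧ V.IsValue ∧ M = ECtx.plug E (.app (.lam N) V) ∧
          M' = E.plug (N.inst V)) ∨
        (∃ E r V, a = .read r V ∧ M = ECtx.plug E (.get (.reg r)) ∧ M' = E.plug V.1) ∨
        (∃ E r V, a = .write r V ∧ M = ECtx.plug E (.set (.reg r) V.1) ∧ M' = E.plug .star) := by
      clear ha
      induction hs with
      | beta N hV => exact .inl ⟨.hole, N, _, rfl, hV, rfl, rfl⟩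
      | read r V => exact .inr (.inl ⟨.hole, r, V, rfl, rfl, rfl⟩)
      | write r hV => exact .inr (.inr ⟨.hole, r, ⟨_, hV⟩, rfl, rfl, rfl⟩)
      | appL N _ ih =>
        rcases ih with ⟨E, K, V, h, hV, rfl, rfl⟩ | ⟨E, r, V, h, rfl, rfl⟩ | ⟨E, r, V, h, rfl, rfl⟩
        · exact .inl ⟨.appL E N, K, V, h, hV, rfl, rfl⟩
        · exact .inr (.inl ⟨.appL E N, r, V, h, rfl, rfl⟩)
        · exact .inr (.inr ⟨.appL E N, r, V, h, rfl, rfl⟩)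
      | appR hW _ ih =>
        rcases ih with ⟨E, K, V, h, hV, rfl, rfl⟩ | ⟨E, r, V, h, rfl, rfl⟩ | ⟨E, r, V, h, rfl, rfl⟩
        · exact .inl ⟨.appR ⟨_, hW⟩ E, K, V, h, hV, rfl, rfl⟩
        · exact .inr (.inl ⟨.appR ⟨_, hW⟩ E, r, V, h, rfl, rfl⟩)
        · exact .inr (.inr ⟨.appR ⟨_, hW⟩ E, r, V, h, rfl, rfl⟩)
      | get _ ih =>
        rcases ih with ⟨E, K, V, h, hV, rfl, rfl⟩ | ⟨E, r, V, h, rfl, rfl⟩ | ⟨E, r, V, h, rfl, rfl⟩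
        · exact .inl ⟨.get E, K, V, h, hV, rfl, rfl⟩
        · exact .inr (.inl ⟨.get E, r, V, h, rfl, rfl⟩)
        · exact .inr (.inr ⟨.get E, r, V, h, rfl, rfl⟩)
      | setL N _ ih =>
        rcases ih with ⟨E, K, V, h, hV, rfl, rfl⟩ | ⟨E, r, V, h, rfl, rfl⟩ | ⟨E, r, V, h, rfl, rfl⟩
        · exact .inl ⟨.setL E N, K, V, h, hV, rfl, rfl⟩
        · exact .inr (.inl ⟨.setL E N, r, V, h, rfl, rfl⟩)
        · exact .inr (.inr ⟨.setL E N, r, V, h, rfl, rfl⟩)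
      | setR hW _ ih =>
        rcases ih with ⟨E, K, V, h, hV, rfl, rfl⟩ | ⟨E, r, V, h, rfl, rfl⟩ | ⟨E, r, V, h, rfl, rfl⟩
        · exact .inl ⟨.setR ⟨_, hW⟩ E, K, V, h, hV, rfl, rfl⟩
        · exact .inr (.inl ⟨.setR ⟨_, hW⟩ E, r, V, h, rfl, rfl⟩)
        · exact .inr (.inr ⟨.setR ⟨_, hW⟩ E, r, V, h, rfl, rfl⟩)
    rcases key with ⟨E, N, V, rfl, hV, rfl, rfl⟩ | ⟨E, r, V, rfl, rfl, rfl⟩ |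
      ⟨E, r, V, rfl, rfl, rfl⟩
    · convert Red.par ⟨Ts, S⟩ (Red.beta E N ⟨V, hV⟩) using 1 <;>
        simp [Prog.par, Prog.thread, Prog.single, Store.empty_union, Store.update]
    · have hS : (Store.cell r {V}).union S = S := by
        rw [Store.union_comm]
        exact Store.union_cell_eq_self.2 ha
      convert Red.par ⟨Ts, S⟩ (Red.get E r V) using 1 <;>
        simp [Prog.par, Prog.thread, Prog.single, Prog.cell, Store.empty_union, Store.update, hS]
    · convert Red.par ⟨Ts, S⟩ (Red.set E r V) using 1 <;>
        simp [Prog.par, Prog.thread, Prog.single, Prog.cell, Store.empty_union, Store.update,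
          Store.union_comm S]

theorem red_single_iff {M : Tm Reg} {S : Store Reg} {P : Prog Reg} :
    Red (Prog.single M S) P ↔
      ∃ a M', LStep M a M' ∧ a.Enabled S ∧ P = Prog.single M' (S.update a) := by
  rw [red_iff]
  constructor
  · rintro ⟨N, Ts, a, M', hT, hs, ha, rfl⟩
    obtain ⟨rfl, rfl⟩ : M = N ∧ Ts = 0 := (Multiset.singleton_eq_cons_iff Ts).1 hT
    exact ⟨a, M', hs, ha, rfl⟩
  · rintro ⟨a, M', hs, ha, rfl⟩
    exact ⟨M, 0, a, M', rfl, hs, ha, rfl⟩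

theorem terminates_iff_acc {P : Prog Reg} : Terminates P ↔ Acc (fun Q P => Red P Q) P := by
  rw [Terminates, ← not_acc_iff_exists_descending_chain (r := fun Q P => Red P Q), not_not]

/-! ### Evaluation in a store that it does not change -/

/-- `Safe S C M`: evaluation of `M` in the store `S` always terminates, never adds anything to
`S`, and every normal form it reaches satisfies `C`. -/
inductive Safe (S : Store Reg) (C : Tm Reg → Prop) : Tm Reg → Prop
  | intro {M : Tm Reg} :
      (∀ a M', LStep M a M' → a.Enabled S → S.update a = S) →
      (∀ a M', LStep M a M' → a.Enabled S → Safe S C M') →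
      ((∀ a M', LStep M a M' → ¬ a.Enabled S) → C M) → Safe S C M

theorem Store.val_subset_update (S : Store Reg) (a : Act Reg) (r : Reg) :
    S.val r ⊆ (S.update a).val r := by
  cases a with
  | write s V => exact Set.subset_union_left
  | _ => exact subset_rfl

theorem Conv.val_subset {M N : Tm Reg} {S T : Store Reg} (h : Conv M S N T) (r : Reg) :
    S.val r ⊆ T.val r := by
  have key : ∀ P Q : Prog Reg, Relation.ReflTransGen Red P Q →
      P.store.val r ⊆ Q.store.val r := by
    intro P Q h
    induction h with
    | refl => exact subset_rfl
    | tail _ h ih =>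
      obtain ⟨_, _, a, _, _, _, _, rfl⟩ := red_iff.1 h
      exact ih.trans (Store.val_subset_update _ a r)
  exact key _ _ h.1

theorem exists_conv {M : Tm Reg} {S : Store Reg} (h : SN M S) : ∃ N T, Conv M S N T := by
  replace h := terminates_iff_acc.1 h
  generalize hP : Prog.single M S = P at h
  induction h generalizing M S with
  | intro P _ ih =>
    subst hP
    by_cases hn : ∃ Q, Red (Prog.single M S) Q
    · obtain ⟨Q, hQ⟩ := hn
      obtain ⟨a, M', _, _, rfl⟩ := red_single_iff.1 hQ
      obtain ⟨N, T, h₁, h₂⟩ := ih _ hQ rfl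
      exact ⟨N, T, .head hQ h₁, h₂⟩
    · exact ⟨M, S, .refl, not_exists.1 hn⟩

/-- Stores only grow under reduction, so a terminating evaluation that restores the store at the
end has never changed it. -/
theorem safe_iff {S : Store Reg} {C : Tm Reg → Prop} {M : Tm Reg} :
    Safe S C M ↔ SN M S ∧ ∀ M' S', Conv M S M' S' → S' = S ∧ C M' := by
  constructor
  · intro h
    induction h with
    | @intro M h₁ h₂ h₃ ih =>
      constructor
      · refine terminates_iff_acc.2 ⟨_, fun P hP => ?_⟩
        obtain ⟨a, M', hs, ha, rfl⟩ := red_single_iff.1 hP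
        rw [h₁ a M' hs ha]
        exact terminates_iff_acc.1 (ih a M' hs ha).1
      · rintro N T ⟨hr, hn⟩
        rcases Relation.ReflTransGen.cases_head hr with heq | ⟨P, hP, hr⟩
        · obtain ⟨rfl, rfl⟩ : M = N ∧ S = T := by simpa [Prog.single] using heq
          exact ⟨rfl, h₃ fun a M' hs ha => hn _ (red_single_iff.2 ⟨a, M', hs, ha, rfl⟩)⟩
        · obtain ⟨a, M', hs, ha, rfl⟩ := red_single_iff.1 hP
          rw [h₁ a M' hs ha] at hr
          exact (ih a M' hs ha).2 N T ⟨hr, hn⟩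
  · rintro ⟨h, hc⟩
    replace h := terminates_iff_acc.1 h
    generalize hP : Prog.single M S = P at h
    induction h generalizing M with
    | intro P hacc ih =>
      subst hP
      have hup : ∀ a M', LStep M a M' → a.Enabled S → S.update a = S := by
        intro a M' hs ha
        have hR := red_single_iff.2 ⟨a, M', hs, ha, rfl⟩
        obtain ⟨N, T, hN⟩ := exists_conv (terminates_iff_acc.2 (hacc _ hR))
        obtain ⟨rfl, -⟩ := hc N T ⟨.head hR hN.1, hN.2⟩
        cases a with
        | write r V =>
          exact Store.union_cell_eq_self.2 (hN.val_subset r (by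
            simp [Store.update, Store.union, Store.cell]))
        | _ => rfl
      refine .intro hup (fun a M' hs ha => ?_) fun hn => ?_
      · have hR : Red (Prog.single M S) (Prog.single M' S) :=
          red_single_iff.2 ⟨a, M', hs, ha, by rw [hup a M' hs ha]⟩
        exact ih _ hR (fun N T hN => hc N T ⟨.head hR hN.1, hN.2⟩) rfl
      · refine (hc M S ⟨.refl, fun P hP => ?_⟩).2
        obtain ⟨a, M', hs, ha, -⟩ := red_single_iff.1 hP
        exact hn a M' hs ha

theorem Safe.of_isValue {S : Store Reg} {C : Tm Reg → Prop} {V : Tm Reg} (hV : V.IsValue)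
    (hC : C V) : Safe S C V :=
  .intro (fun _ _ h => absurd h hV.not_lStep) (fun _ _ h => absurd h hV.not_lStep) fun _ => hC

theorem Safe.prop_of_isValue {S : Store Reg} {C : Tm Reg → Prop} {V : Tm Reg} (hV : V.IsValue)
    (h : Safe S C V) : C V := by
  cases h with
  | intro _ _ h => exact h fun _ _ hs => absurd hs hV.not_lStep

theorem Safe.imp {S : Store Reg} {C D : Tm Reg → Prop} {M : Tm Reg} (h : Safe S C M)
    (hCD : ∀ M', C M' → D M') : Safe S D M := by
  induction h with
  | intro h₁ _ h₃ ih => exact .intro h₁ ih fun hn => hCD _ (h₃ hn)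

/-- Evaluating the term in the hole of a frame first, and then the frame filled with the
resulting value. -/
theorem Safe.bind {S : Store Reg} {C D : Tm Reg → Prop} {F : Tm Reg → Tm Reg} (hF : IsFrame F)
    {M : Tm Reg} (h : Safe S C M) (hC : ∀ V, C V → V.IsValue)
    (hD : ∀ V, C V → Safe S D (F V)) : Safe S D (F M) := by
  induction h with
  | @intro M h₁ h₂ h₃ ih =>
    by_cases hM : M.IsValue
    · exact hD M (Safe.prop_of_isValue hM (.intro h₁ h₂ h₃))
    · refine .intro (fun a N hs ha => ?_) (fun a N hs ha => ?_) fun hn => ?_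
      · obtain ⟨M', hs', rfl⟩ := hF.inv hM hs
        exact h₁ a M' hs' ha
      · obtain ⟨M', hs', rfl⟩ := hF.inv hM hs
        exact ih a M' hs' ha
      · exact absurd (hC M (h₃ fun a M' hs' => hn a _ (hF.lift hs'))) hM

/-- Threads that are all safe for the store `S` terminate together from any smaller store:
interaction between the threads is confined to values that `S` already provides. -/
theorem terminates_of_safe {S : Store Reg} {C : Tm Reg → Prop} {P : Prog Reg}
    (hP : ∀ M ∈ P.threads, Safe S C M) (hS : ∀ r, P.store.val r ⊆ S.val r) : Terminates P := by
  let r : Tm Reg → Tm Reg → Prop := fun M' M =>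
    Safe S C M ∧ ∃ a, LStep M a M' ∧ a.Enabled S
  have hr : WellFounded r := by
    refine ⟨fun M => ⟨M, fun M' hM' => ?_⟩⟩
    have h : ∀ M, Safe S C M → Acc r M := by
      intro M hM
      induction hM with
      | intro h₁ h₂ h₃ ih => exact ⟨_, fun M' ⟨_, a, hs, ha⟩ => ih a M' hs ha⟩
    exact (h M hM'.1).inv hM'
  rw [terminates_iff_acc]
  obtain ⟨T, U⟩ := P
  have hacc := hr.cutExpand.apply T
  induction hacc generalizing U with
  | intro T _ ih =>
    refine ⟨_, fun Q hQ => ?_⟩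
    obtain ⟨M, Ts, a, M', rfl, hs, ha, rfl⟩ := red_iff.1 hQ
    have hM : Safe S C M := hP M (Multiset.mem_cons_self M Ts)
    have haS : a.Enabled S := by
      cases a with
      | read s V => exact hS s ha
      | _ => trivial
    have hstep : S.update a = S ∧ Safe S C M' := by
      cases hM with
      | intro h₁ h₂ _ => exact ⟨h₁ a M' hs haS, h₂ a M' hs haS⟩
    refine ih _ (Relation.cutExpand_single_add ⟨hM, a, hs, haS⟩ Ts) _ ?_ ?_
    · intro N hN
      rcases Multiset.mem_cons.1 hN with rfl | hN
      · exact hstep.2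
      · exact hP N (Multiset.mem_cons_of_mem hN)
    · intro s
      cases a with
      | write t V =>
        have hV : V ∈ S.val t := Store.union_cell_eq_self.1 hstep.1
        rintro W (hW | ⟨rfl, hW⟩)
        · exact hS s hW
        · obtain rfl : W = V := hW
          exact hV
      | _ => exact hS s

end Operational

/-! ### Substitution and canonical values -/

section Substitution

variable {Reg : Type u}

theorem upSubst_var : upSubst (Tm.var : ℕ → Tm Reg) = Tm.var := by
  funext x
  cases x <;> rfl

theorem Tm.subst_var (M : Tm Reg) : M.subst Tm.var = M := by
  induction M <;> simp_all [Tm.subst, upSubst_var]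

theorem Tm.subst_rename (M : Tm Reg) (ρ : ℕ → ℕ) (σ : ℕ → Tm Reg) :
    (M.rename ρ).subst σ = M.subst (σ ∘ ρ) := by
  induction M generalizing ρ σ with
  | lam M ih =>
    have h : upSubst σ ∘ upRen ρ = upSubst (σ ∘ ρ) := by
      funext x
      cases x <;> rfl
    simp [Tm.subst, Tm.rename, ih, h]
  | _ => simp_all [Tm.subst, Tm.rename]

theorem Tm.rename_rename (M : Tm Reg) (ρ τ : ℕ → ℕ) :
    (M.rename ρ).rename τ = M.rename (τ ∘ ρ) := by
  induction M generalizing ρ τ with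
  | lam M ih =>
    have h : upRen τ ∘ upRen ρ = upRen (τ ∘ ρ) := by
      funext x
      cases x <;> rfl
    simp [Tm.rename, ih, h]
  | _ => simp_all [Tm.rename]

theorem Tm.rename_subst (M : Tm Reg) (σ : ℕ → Tm Reg) (ρ : ℕ → ℕ) :
    (M.subst σ).rename ρ = M.subst (fun x => (σ x).rename ρ) := by
  induction M generalizing ρ σ with
  | lam M ih =>
    have h : (fun x => (upSubst σ x).rename (upRen ρ)) = upSubst fun x => (σ x).rename ρ := by
      funext x
      cases x with
      | zero => rfl
      | succ x =>
        simp only [upSubst, Tm.rename_rename]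
        rfl
    simp [Tm.subst, Tm.rename, ih, h]
  | _ => simp_all [Tm.subst, Tm.rename]

theorem Tm.subst_subst (M : Tm Reg) (σ τ : ℕ → Tm Reg) :
    (M.subst σ).subst τ = M.subst (fun x => (σ x).subst τ) := by
  induction M generalizing τ σ with
  | lam M ih =>
    have h : (fun x => (upSubst σ x).subst (upSubst τ)) = upSubst fun x => (σ x).subst τ := by
      funext x
      cases x with
      | zero => rfl
      | succ x =>
        simp only [upSubst, Tm.subst_rename, Tm.rename_subst]
        rfl
    simp [Tm.subst, ih, h]
  | _ => simp_all [Tm.subst]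

/-- The substitution sending the variable `0` to `N` and the variable `x + 1` to `σ x`. -/
def consSubst (N : Tm Reg) (σ : ℕ → Tm Reg) : ℕ → Tm Reg
  | 0 => N
  | x + 1 => σ x

theorem Tm.subst_upSubst_inst (M N : Tm Reg) (σ : ℕ → Tm Reg) :
    (M.subst (upSubst σ)).inst N = M.subst (consSubst N σ) := by
  rw [Tm.inst, Tm.subst_subst]
  congr 1
  funext x
  cases x with
  | zero => rfl
  | succ x =>
    simp only [upSubst, Tm.subst_rename, consSubst]
    exact (σ x).subst_var

/-- A canonical closed value of each type; at function types it is a constant function. -/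
def Ty.inhabitant : Ty Reg → Tm Reg
  | .unit => .star
  | .reg r _ => .reg r
  | .arr _ _ B => .lam B.inhabitant

theorem Ty.inhabitant_isValue (A : Ty Reg) : A.inhabitant.IsValue := by
  cases A <;> constructor

theorem Ty.inhabitant_subst (A : Ty Reg) (σ : ℕ → Tm Reg) :
    A.inhabitant.subst σ = A.inhabitant := by
  induction A generalizing σ with
  | unit => rfl
  | reg r A => rfl
  | arr A e B _ ih => simp [Ty.inhabitant, Tm.subst, ih]

end Substitution

/-! ### Region contexts, types and subtyping -/

section Contexts

variable {Reg : Type u} [DecidableEq Reg] {R R' R₁ : RCtx Reg}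

theorem Extends.refl (h : RCtx.WF R) : Extends R R := ⟨h, List.suffix_rfl⟩

theorem Extends.trans (h₁ : Extends R₁ R') (h₂ : Extends R' R) : Extends R₁ R :=
  ⟨h₁.1, h₂.2.trans h₁.2⟩

theorem Extends.mem (h : Extends R' R) {r : Reg} {A : Ty Reg} (hr : (r, A) ∈ R) : (r, A) ∈ R' :=
  h.2.subset hr

theorem RCtx.mem_dom {r : Reg} : r ∈ RCtx.dom R ↔ ∃ A, (r, A) ∈ R := by
  simp [RCtx.dom]

theorem Extends.dom_subset (h : Extends R' R) : RCtx.dom R ⊆ RCtx.dom R' := by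
  intro r hr
  obtain ⟨A, hA⟩ := RCtx.mem_dom.1 hr
  exact RCtx.mem_dom.2 ⟨A, h.mem hA⟩

theorem Ty.WF.mono (h : Extends R' R) {A : Ty Reg} (hA : Ty.WF R A) : Ty.WF R' A := by
  induction A with
  | unit => exact .unit h.1
  | reg r A => cases hA with | reg _ hr => exact .reg h.1 (h.mem hr)
  | arr A e B ih₁ ih₂ =>
    cases hA with | arr h₁ h₂ h₃ => exact .arr (ih₁ h₁) (ih₂ h₂) (h₃.trans h.dom_subset)

/-- In a well-formed region context the type of a region is well-formed in a prefix of it. -/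
theorem RCtx.WF.exists_prefix (h : RCtx.WF R) {r : Reg} {A : Ty Reg} (hr : (r, A) ∈ R) :
    ∃ R₁, (r, A) :: R₁ <:+ R ∧ Ty.WF R₁ A := by
  obtain ⟨R₂, R₁, rfl⟩ := List.append_of_mem hr
  have hs : (r, A) :: R₁ <:+ R₂ ++ (r, A) :: R₁ := List.suffix_append _ _
  exact ⟨R₁, hs, (RCtx.WF.tail (Extends.wf_of_wf h hs)).1⟩

theorem RCtx.WF.wf_of_mem (h : RCtx.WF R) {r : Reg} {A : Ty Reg} (hr : (r, A) ∈ R) :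
    Ty.WF R A := by
  obtain ⟨R₁, hs, hA⟩ := h.exists_prefix hr
  exact hA.mono ⟨h, (List.suffix_cons _ _).trans hs⟩

theorem RCtx.WF.unique (h : RCtx.WF R) {r : Reg} {A B : Ty Reg} (hA : (r, A) ∈ R)
    (hB : (r, B) ∈ R) : A = B := by
  induction R with
  | nil => simp at hA
  | cons p R ih =>
    obtain ⟨s, C⟩ := p
    obtain ⟨hC, hs⟩ := RCtx.WF.tail h
    have hne : ∀ D, (s, D) ∉ R := fun D hD => hs (RCtx.mem_dom.2 ⟨D, hD⟩)
    rcases List.mem_cons.1 hA with hA' | hA' <;> rcases List.mem_cons.1 hB with hB' | hB'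
    · cases hA'; cases hB'; rfl
    · cases hA'; exact absurd hB' (hne _)
    · cases hB'; exact absurd hA' (hne _)
    · exact ih hC.rctx hA' hB'

theorem Sub.wf {A B : Ty Reg} (h : Sub R A B) : Ty.WF R A ∧ Ty.WF R B := by
  induction h with
  | refl h => exact ⟨h, h⟩
  | arr _ _ he he' ih₁ ih₂ => exact ⟨.arr ih₁.2 ih₂.1 (he.trans he'), .arr ih₁.1 ih₂.2 he'⟩

theorem Sub.mono (hR : Extends R' R) {A B : Ty Reg} (h : Sub R A B) : Sub R' A B := by
  induction h with
  | refl h => exact .refl (h.mono hR)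
  | arr _ _ he he' ih₁ ih₂ => exact .arr ih₁ ih₂ he (he'.trans hR.dom_subset)

theorem CtxWF.mono (hR : Extends R' R) {Γ : List (Ty Reg)} (h : CtxWF R Γ) : CtxWF R' Γ :=
  ⟨hR.1, fun A hA => (h.2 A hA).mono hR⟩

theorem CtxWF.nil (h : RCtx.WF R) : CtxWF R [] := ⟨h, by simp⟩

theorem CtxWF.cons {Γ : List (Ty Reg)} {A : Ty Reg} (hA : Ty.WF R A) (h : CtxWF R Γ) :
    CtxWF R (A :: Γ) :=
  ⟨h.1, by simpa using ⟨hA, h.2⟩⟩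

end Contexts

/-! ### Typing -/

section Typing

variable {Reg : Type u} [DecidableEq Reg] {R R' : RCtx Reg} {Γ Δ : List (Ty Reg)}
  {M : Tm Reg} {A : Ty Reg} {e : Finset Reg}

theorem HasType.ctxWF (h : HasType R Γ M A e) : CtxWF R Γ := by
  induction h with
  | lam _ ih => exact ⟨ih.1, fun B hB => ih.2 B (List.mem_cons_of_mem _ hB)⟩
  | _ => assumption

theorem HasType.wf (h : HasType R Γ M A e) : Ty.WF R A ∧ e ⊆ RCtx.dom R := by
  induction h with
  | var hΓ hx => exact ⟨hΓ.2 _ (List.mem_of_getElem? hx), by simp⟩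
  | reg hΓ hr => exact ⟨.reg hΓ.1 hr, by simp⟩
  | star hΓ => exact ⟨.unit hΓ.1, by simp⟩
  | lam h ih => exact ⟨.arr (h.ctxWF.2 _ List.mem_cons_self) ih.1 ih.2, by simp⟩
  | app _ _ ih₁ ih₂ =>
    cases ih₁.1 with
    | arr _ hB he => exact ⟨hB, Finset.union_subset (Finset.union_subset ih₁.2 he) ih₂.2⟩
  | get _ ih =>
    cases ih.1 with
    | reg hR hr =>
      exact ⟨hR.wf_of_mem hr, Finset.union_subset ih.2 (by simpa using RCtx.mem_dom.2 ⟨_, hr⟩)⟩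
  | set _ _ ih₁ ih₂ =>
    cases ih₁.1 with
    | reg hR hr =>
      exact ⟨.unit hR, Finset.union_subset (Finset.union_subset ih₁.2 ih₂.2)
        (by simpa using RCtx.mem_dom.2 ⟨_, hr⟩)⟩
  | sub _ hs _ => exact ⟨hs.1.wf.2, hs.2.2⟩

theorem HasType.mono (hR : Extends R' R) (h : HasType R Γ M A e) : HasType R' Γ M A e := by
  induction h with
  | var hΓ hx => exact .var (hΓ.mono hR) hx
  | reg hΓ hr => exact .reg (hΓ.mono hR) (hR.mem hr)
  | star hΓ => exact .star (hΓ.mono hR)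
  | lam _ ih => exact .lam ih
  | app _ _ ih₁ ih₂ => exact .app ih₁ ih₂
  | get _ ih => exact .get ih
  | set _ _ ih₁ ih₂ => exact .set ih₁ ih₂
  | sub _ hs ih => exact .sub ih ⟨hs.1.mono hR, hs.2.1, hs.2.2.trans hR.dom_subset⟩

theorem HasType.rename (h : HasType R Γ M A e) {ρ : ℕ → ℕ} (hΔ : CtxWF R Δ)
    (hρ : ∀ (x : ℕ) (B : Ty Reg), Γ[x]? = some B → Δ[ρ x]? = some B) :
    HasType R Δ (M.rename ρ) A e := by
  induction h generalizing Δ ρ with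
  | var hΓ hx => exact .var hΔ (hρ _ _ hx)
  | reg hΓ hr => exact .reg hΔ hr
  | star hΓ => exact .star hΔ
  | lam h ih =>
    refine .lam (ih (.cons (h.ctxWF.2 _ List.mem_cons_self) hΔ) fun x B hx => ?_)
    cases x with
    | zero => simpa [upRen] using hx
    | succ x => simpa [upRen] using hρ x B (by simpa using hx)
  | app _ _ ih₁ ih₂ => exact .app (ih₁ hΔ hρ) (ih₂ hΔ hρ)
  | get _ ih => exact .get (ih hΔ hρ)
  | set _ _ ih₁ ih₂ => exact .set (ih₁ hΔ hρ) (ih₂ hΔ hρ)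
  | sub _ hs ih => exact .sub (ih hΔ hρ) hs

theorem HasType.subst (h : HasType R Γ M A e) {σ : ℕ → Tm Reg} (hΔ : CtxWF R Δ)
    (hσ : ∀ (x : ℕ) (B : Ty Reg), Γ[x]? = some B → HasType R Δ (σ x) B ∅) :
    HasType R Δ (M.subst σ) A e := by
  induction h generalizing Δ σ with
  | var hΓ hx => exact hσ _ _ hx
  | reg hΓ hr => exact .reg hΔ hr
  | star hΓ => exact .star hΔ
  | lam h ih =>
    have hΔ' := CtxWF.cons (h.ctxWF.2 _ List.mem_cons_self) hΔ
    refine .lam (ih hΔ' fun x B hx => ?_)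
    cases x with
    | zero => exact .var hΔ' (by simpa using hx)
    | succ x => exact (hσ x B (by simpa using hx)).rename hΔ' fun y C hy => by simpa using hy
  | app _ _ ih₁ ih₂ => exact .app (ih₁ hΔ hσ) (ih₂ hΔ hσ)
  | get _ ih => exact .get (ih hΔ hσ)
  | set _ _ ih₁ ih₂ => exact .set (ih₁ hΔ hσ) (ih₂ hΔ hσ)
  | sub _ hs ih => exact .sub (ih hΔ hσ) hs

theorem HasType.narrow {B B' : Ty Reg} (h : HasType R (B :: Γ) M A e) (hB : Sub R B' B) :
    HasType R (B' :: Γ) M A e := by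
  have hΓ : CtxWF R (B' :: Γ) :=
    .cons hB.wf.1 ⟨h.ctxWF.1, fun C hC => h.ctxWF.2 C (List.mem_cons_of_mem _ hC)⟩
  rw [← M.subst_var]
  refine h.subst hΓ fun x C hx => ?_
  cases x with
  | zero =>
    obtain rfl : B = C := by simpa using hx
    exact .sub (.var hΓ rfl) ⟨hB, by simp, by simp⟩
  | succ x => exact .var hΓ (by simpa using hx)

theorem HasType.reg_inv {r s : Reg} (h : HasType R Γ (.reg r) (.reg s A) e) :
    r = s := by
  generalize hM : Tm.reg r = M at h
  generalize hB : Ty.reg s A = B at h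
  induction h with
  | reg => cases hM; cases hB; rfl
  | sub _ hs ih =>
    subst hB
    cases hs.1
    exact ih hM rfl
  | _ => cases hM

theorem HasType.lam_inv {B : Ty Reg} {e' : Finset Reg}
    (h : HasType R Γ (.lam M) (.arr A e B) e') : HasType R (A :: Γ) M B e := by
  generalize hN : Tm.lam M = N at h
  generalize hC : Ty.arr A e B = C at h
  induction h generalizing A e B with
  | lam h => cases hN; cases hC; exact h
  | sub _ hs ih =>
    subst hC
    cases hs.1 with
    | refl => exact ih hN rfl
    | arr h₁ h₂ he he' => exact .sub ((ih hN rfl).narrow h₁) ⟨h₂, he, he'⟩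
  | _ => cases hN

theorem HasType.value {V : Tm Reg} (hV : V.IsValue) (h : HasType R Γ V A e) :
    HasType R Γ V A ∅ := by
  induction h with
  | var => cases hV
  | reg hΓ hr => exact .reg hΓ hr
  | star hΓ => exact .star hΓ
  | lam h => exact .lam h
  | app => cases hV
  | get => cases hV
  | set => cases hV
  | sub _ hs ih => exact .sub (ih hV) ⟨hs.1, subset_rfl, by simp⟩

theorem HasType.weakenEffect {e' : Finset Reg} (h : HasType R Γ M A e) (he : e ⊆ e')
    (he' : e' ⊆ RCtx.dom R) : HasType R Γ M A e' :=
  .sub h ⟨.refl h.wf.1, he, he'⟩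

theorem HasType.inst {N : Tm Reg} {B : Ty Reg} (h : HasType R (B :: Γ) M A e)
    (hN : HasType R Γ N B ∅) : HasType R Γ (M.inst N) A e := by
  refine h.subst hN.ctxWF fun x C hx => ?_
  cases x with
  | zero =>
    obtain rfl : B = C := by simpa using hx
    exact hN
  | succ x => exact .var hN.ctxWF (by simpa using hx)

/-- Effects are sound: a step only touches regions in the effect of the term. -/
theorem HasType.regions_subset (h : HasType R Γ M A e) {a : Act Reg} {M' : Tm Reg}
    (hs : LStep M a M') : a.regions ⊆ e := by
  induction h generalizing M' with
  | app _ _ ih₁ ih₂ =>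
    cases hs with
    | beta => simp [Act.regions]
    | appL _ hs => exact (ih₁ hs).trans (by grind)
    | appR _ hs => exact (ih₂ hs).trans (by grind)
  | get h ih =>
    cases hs with
    | read r V => simp [Act.regions, h.reg_inv]
    | get hs => exact (ih hs).trans (by grind)
  | set h _ ih₁ ih₂ =>
    cases hs with
    | write r hV => simp [Act.regions, h.reg_inv]
    | setL _ hs => exact (ih₁ hs).trans (by grind)
    | setR _ hs => exact (ih₂ hs).trans (by grind)
  | sub _ hs' ih => exact (ih hs).trans hs'.2.1
  | _ => cases hs

/-- The values that an action obtains from the store have the type of their region. -/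
def Act.Typed (R : RCtx Reg) : Act Reg → Prop
  | .read r V => ∀ A, (r, A) ∈ R → HasType R [] V.1 A ∅
  | _ => True

/-- Subject reduction. -/
theorem HasType.lStep (h : HasType R [] M A e) {a : Act Reg} {M' : Tm Reg} (hs : LStep M a M')
    (ha : a.Typed R) : HasType R [] M' A e := by
  generalize hΓ : ([] : List (Ty Reg)) = Γ at h
  induction h generalizing M' with
  | app h₁ h₂ ih₁ ih₂ =>
    have hd := (HasType.app h₁ h₂).wf.2
    subst hΓ
    cases hs with
    | beta M hV => exact (h₁.lam_inv.inst (h₂.value hV)).weakenEffect (by grind) hd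
    | appL _ hs => exact .app (ih₁ hs rfl) h₂
    | appR _ hs => exact .app h₁ (ih₂ hs rfl)
  | get h ih =>
    have hd := (HasType.get h).wf.2
    subst hΓ
    cases hs with
    | read r V =>
      obtain rfl := h.reg_inv
      cases h.wf.1 with
      | reg _ hr => exact (ha _ hr).weakenEffect (by simp) hd
    | get hs => exact .get (ih hs rfl)
  | set h₁ h₂ ih₁ ih₂ =>
    have hd := (HasType.set h₁ h₂).wf.2
    subst hΓ
    cases hs with
    | write r hV => exact (HasType.star h₁.ctxWF).weakenEffect (by simp) hd
    | setL _ hs => exact .set (ih₁ hs rfl) h₂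
    | setR _ hs => exact .set h₁ (ih₂ hs rfl)
  | sub _ hs' ih => exact .sub (ih hs hΓ) hs'
  | _ => cases hs

/-- Evaluation of a typed term only depends on the part of the store in its effect, and it may be
assumed that the normal forms are typed. -/
theorem Safe.transfer {S T : Store Reg} {C D : Tm Reg → Prop} (h : Safe S C M)
    (hM : HasType R [] M A e)
    (hS : ∀ r ∈ e, ∀ B, (r, B) ∈ R → ∀ V ∈ S.val r, HasType R [] V.1 B ∅)
    (hST : ∀ r ∈ e, S.val r = T.val r)
    (hCD : ∀ M', HasType R [] M' A e → C M' → D M') : Safe T D M := by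
  induction h with
  | @intro M h₁ h₂ h₃ ih =>
    have hen : ∀ a M', LStep M a M' → (a.Enabled T ↔ a.Enabled S) := by
      intro a M' hs
      have hr := hM.regions_subset hs
      cases a with
      | read r V => simp only [Act.Enabled, hST r (by simpa [Act.regions] using hr)]
      | _ => rfl
    refine .intro (fun a M' hs ha => ?_) (fun a M' hs ha => ?_) fun hn => ?_
    · have hup := h₁ a M' hs ((hen a M' hs).1 ha)
      have hr := hM.regions_subset hs
      cases a with
      | write r V =>
        refine Store.union_cell_eq_self.2 ?_
        rw [← hST r (by simpa [Act.regions] using hr)]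
        exact Store.union_cell_eq_self.1 hup
      | _ => rfl
    · have ha' := (hen a M' hs).1 ha
      refine ih a M' hs ha' (hM.lStep hs ?_)
      have hr := hM.regions_subset hs
      cases a with
      | read r V =>
        exact fun B hB => hS r (by simpa [Act.regions] using hr) B hB V ha'
      | _ => trivial
    · exact hCD M hM (h₃ fun a M' hs ha => hn a M' hs ((hen a M' hs).2 ha))

end Typing

/-! ### Saturated stores and reducibility -/

section Reducibility

variable {Reg : Type u} [DecidableEq Reg] {R R' R₁ : RCtx Reg} {A : Ty Reg} {e : Finset Reg}
  {M : Tm Reg}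

theorem reducible_iff {sat : RCtx Reg → Store Reg} {C : RCtx Reg → Tm Reg → Prop} :
    Reducible R sat C A e R' M ↔ Extends R' R ∧ HasType R' [] M A e ∧
      ∀ R'', Extends R'' R' → Safe (sat R'') (C R'') M := by
  simp only [Reducible, safe_iff]
  grind

theorem mem_sem_iff_safe : (R', M) ∈ sem R A e ↔ Extends R' R ∧ HasType R' [] M A e ∧
    ∀ R'', Extends R'' R' → Safe (satStore R R'') (CPred R (satStore R) A R'') M :=
  reducible_iff

theorem mem_satStore (h : Extends R' R) {r : Reg} (hs : (r, A) :: R₁ <:+ R) {V : Val Reg} :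
    V ∈ (satStore R R').val r ↔ (R', V.1) ∈ sem R₁ A ∅ := by
  rw [((mem_semCtx_iff h _).2 rfl).2.2 R₁ r A hs]
  rfl

theorem satStore_val_eq (h : Extends R' R) (h₁ : Extends R₁ R') {r : Reg}
    (hr : r ∈ RCtx.dom R) : (satStore R R₁).val r = (satStore R' R₁).val r := by
  obtain ⟨A, hA⟩ := RCtx.mem_dom.1 hr
  obtain ⟨R₂, hs, -⟩ := (Extends.wf_of_wf h.1 h.2).exists_prefix hA
  ext V
  rw [mem_satStore (h₁.trans h) hs, mem_satStore h₁ (hs.trans h.2)]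

theorem satStore_typed (h : Extends R' R) {r : Reg} (hr : r ∈ RCtx.dom R) {B : Ty Reg}
    (hB : (r, B) ∈ R') {V : Val Reg} (hV : V ∈ (satStore R R').val r) :
    HasType R' [] V.1 B ∅ := by
  obtain ⟨A, hA⟩ := RCtx.mem_dom.1 hr
  obtain ⟨R₂, hs, -⟩ := (Extends.wf_of_wf h.1 h.2).exists_prefix hA
  obtain rfl := h.1.unique (h.mem hA) hB
  exact ((mem_satStore h hs).1 hV).1.2

theorem CPred.isValue {sat : RCtx Reg → Store Reg} (h : CPred R sat A R' M) : M.IsValue := by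
  cases A with
  | unit => obtain rfl : M = .star := h; exact .star
  | reg r A => obtain rfl : M = .reg r := h; exact .reg r
  | arr A e B => obtain ⟨⟨N, rfl⟩, -⟩ := h; exact .lam N

theorem CPred.mono {sat : RCtx Reg → Store Reg} (hR : Extends R₁ R') (h : CPred R sat A R' M) :
    CPred R sat A R₁ M := by
  cases A with
  | unit => exact h
  | reg r A => exact h
  | arr A e B => exact ⟨h.1, fun R₂ V h₂ => h.2 R₂ V (h₂.trans hR)⟩

theorem sem_mono (hR : Extends R₁ R') (h : (R', M) ∈ sem R A e) : (R₁, M) ∈ sem R A e := by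
  rw [mem_sem_iff_safe] at h ⊢
  exact ⟨hR.trans h.1, h.2.1.mono hR, fun R'' h'' => h.2.2 R'' (h''.trans hR)⟩

theorem mem_sem_of_isValue (hM : M.IsValue) (hR : Extends R' R) (ht : HasType R' [] M A e)
    (hC : CPred R (satStore R) A R' M) : (R', M) ∈ sem R A e :=
  mem_sem_iff_safe.2 ⟨hR, ht, fun _ h'' => .of_isValue hM (hC.mono h'')⟩

theorem cPred_of_mem_sem (hM : M.IsValue) (h : (R', M) ∈ sem R A e) :
    CPred R (satStore R) A R' M := by
  rw [mem_sem_iff_safe] at h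
  exact (h.2.2 R' (.refl h.1.1)).prop_of_isValue hM

/-- Evaluation of a reducible term ends in reducible values. -/
theorem safe_mem_sem (h : (R', M) ∈ sem R A e) (he : e ⊆ RCtx.dom R) :
    Safe (satStore R R') (fun V => V.IsValue ∧ (R', V) ∈ sem R A ∅) M := by
  rw [mem_sem_iff_safe] at h
  refine (h.2.2 R' (.refl h.1.1)).transfer h.2.1
    (fun r hr B hB V hV => satStore_typed h.1 (he hr) hB hV) (fun _ _ => rfl)
    fun V hV hC => ⟨hC.isValue, ?_⟩
  exact mem_sem_of_isValue hC.isValue h.1 (hV.value hC.isValue) hC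

/-! ### Restriction of the interpretation to a prefix of the region context -/

theorem reducible_congr {C C' : RCtx Reg → Tm Reg → Prop} (h : Extends R' R)
    (he : e ⊆ RCtx.dom R) (hC : ∀ R'' M, Extends R'' R' → (C R'' M ↔ C' R'' M))
    (h₁ : Extends R₁ R') :
    Reducible R (satStore R) C A e R₁ M ↔ Reducible R' (satStore R') C' A e R₁ M := by
  rw [reducible_iff, reducible_iff]
  refine and_congr (iff_of_true (h₁.trans h) h₁) (and_congr_right fun ht => forall₂_congr ?_)
  intro R'' h''
  have hR' := h''.trans h₁
  have hR := hR'.trans h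
  have heq := fun r (hr : r ∈ e) => satStore_val_eq h hR' (he hr)
  constructor
  · exact fun hs => hs.transfer (ht.mono h'')
      (fun r hr B hB V hV => satStore_typed hR (he hr) hB hV) heq
      fun M' _ => (hC R'' M' hR').1
  · exact fun hs => hs.transfer (ht.mono h'')
      (fun r hr B hB V hV => satStore_typed hR' (h.dom_subset (he hr)) hB hV)
      (fun r hr => (heq r hr).symm) fun M' _ => (hC R'' M' hR').2

theorem cPred_restrict (h : Extends R' R) (hA : Ty.WF R A) (h₁ : Extends R₁ R') :
    CPred R (satStore R) A R₁ M ↔ CPred R' (satStore R') A R₁ M := by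
  induction A generalizing R₁ M with
  | unit => rfl
  | reg r A => rfl
  | arr A e B ih₁ ih₂ =>
    cases hA with
    | arr hA hB he =>
      refine and_congr_right fun _ => forall₃_congr fun R₂ V h₂ => imp_congr ?_ ?_
      · exact reducible_congr h (by simp) (fun R'' M h'' => ih₁ hA h'') (h₂.trans h₁)
      · exact reducible_congr h he (fun R'' M h'' => ih₂ hB h'') (h₂.trans h₁)

/-- The interpretation of a type and effect does not depend on the regions declared after those
that are needed to form them. -/
theorem sem_restrict (h : Extends R' R) (hA : Ty.WF R A) (he : e ⊆ RCtx.dom R)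
    (h₁ : Extends R₁ R') : (R₁, M) ∈ sem R A e ↔ (R₁, M) ∈ sem R' A e :=
  reducible_congr h he (fun _ _ h'' => cPred_restrict h hA h'') h₁

theorem mem_satStore_iff (h : Extends R' R) {r : Reg} (hr : (r, A) ∈ R) {V : Val Reg} :
    V ∈ (satStore R R').val r ↔ (R', V.1) ∈ sem R A ∅ := by
  have hR := Extends.wf_of_wf h.1 h.2
  obtain ⟨R₁, hs, hA⟩ := hR.exists_prefix hr
  rw [mem_satStore h hs]
  exact sem_restrict ⟨hR, (List.suffix_cons _ _).trans hs⟩ hA (by simp) h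

/-! ### Soundness of the typing rules -/

theorem reducible_sub {sat : RCtx Reg → Store Reg} {A' : Ty Reg} {e' : Finset Reg}
    (h : SubEff R A e A' e')
    (hC : ∀ R'' M, Extends R'' R → CPred R sat A R'' M → CPred R sat A' R'' M)
    (hM : Reducible R sat (CPred R sat A) A e R' M) :
    Reducible R sat (CPred R sat A') A' e' R' M := by
  rw [reducible_iff] at hM ⊢
  obtain ⟨hR, ht, hs⟩ := hM
  refine ⟨hR, .sub ht ⟨h.1.mono hR, h.2.1, h.2.2.trans hR.dom_subset⟩, fun R'' h'' => ?_⟩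
  exact (hs R'' h'').imp fun N hN => hC R'' N (h''.trans hR) hN

theorem CPred.sub {sat : RCtx Reg → Store Reg} {A' : Ty Reg} (h : Sub R A A')
    (hR : Extends R' R) (hM : CPred R sat A R' M) : CPred R sat A' R' M := by
  induction h generalizing R' M with
  | refl => exact hM
  | arr h₁ h₂ he he' ih₁ ih₂ =>
    refine ⟨hM.1, fun R₁ V hR₁ hV => ?_⟩
    refine reducible_sub ⟨h₂, he, he'⟩ (fun R'' N h'' hN => ih₂ h'' hN) (hM.2 R₁ V hR₁ ?_)
    exact reducible_sub ⟨h₁, subset_rfl, by simp⟩ (fun R'' N h'' hN => ih₁ h'' hN) hV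

theorem app_lam_mem_sem {V : Tm Reg} (hV : V.IsValue) (ht : HasType R' [] (.app (.lam M) V) A e)
    (h : (R', M.inst V) ∈ sem R A e) : (R', .app (.lam M) V) ∈ sem R A e := by
  rw [mem_sem_iff_safe] at h ⊢
  refine ⟨h.1, ht, fun R₂ hR₂ => ?_⟩
  have hstep : ∀ a N, LStep (.app (.lam M) V) a N → a = .tau ∧ N = M.inst V := by
    intro a N hs
    cases hs with
    | beta => exact ⟨rfl, rfl⟩
    | appL _ hs => cases hs
    | appR _ hs => exact absurd hs hV.not_lStep
  refine .intro (fun a N hs _ => ?_) (fun a N hs _ => ?_) fun hn => ?_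
  · rw [(hstep a N hs).1]; rfl
  · rw [(hstep a N hs).2]; exact h.2.2 R₂ hR₂
  · exact absurd trivial (hn .tau _ (.beta _ hV))

theorem Ty.WF.hasType_inhabitant (hA : Ty.WF R A) {Γ : List (Ty Reg)} (hΓ : CtxWF R Γ) :
    HasType R Γ A.inhabitant A ∅ := by
  induction A generalizing Γ with
  | unit => exact .star hΓ
  | reg r A => cases hA with | reg _ hr => exact .reg hΓ hr
  | arr A e B _ ih =>
    cases hA with
    | arr hA hB he => exact .lam ((ih hB (.cons hA hΓ)).weakenEffect (by simp) he)

/-- Saturated stores are nowhere empty. Without this, `get r` could be stuck. -/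
theorem Ty.WF.inhabitant_mem_sem (hA : Ty.WF R A) (hR : Extends R' R) :
    (R', A.inhabitant) ∈ sem R A ∅ := by
  induction A generalizing R' with
  | unit => exact mem_sem_of_isValue .star hR (.star (.nil hR.1)) rfl
  | reg r A =>
    exact mem_sem_of_isValue (.reg r) hR ((hA.mono hR).hasType_inhabitant (.nil hR.1)) rfl
  | arr A e B _ ih =>
    have ht : HasType R' [] (.lam B.inhabitant) _ ∅ :=
      (hA.mono hR).hasType_inhabitant (.nil hR.1)
    cases hA with
    | arr hA hB he =>
      refine mem_sem_of_isValue (.lam _) hR ht ⟨⟨_, rfl⟩, fun R₁ V hR₁ hV => ?_⟩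
      have hR₁' := hR₁.trans hR
      refine app_lam_mem_sem V.2 ?_ ?_
      · simpa using HasType.app (ht.mono hR₁) hV.1.2
      · rw [Tm.inst, Ty.inhabitant_subst]
        exact reducible_sub ⟨.refl hB, by simp, he⟩ (fun _ _ _ h => h) (ih hB hR₁')

/-- Substituting reducible terms into a typed term yields a reducible term. -/
theorem HasType.subst_mem_sem {Γ : List (Ty Reg)} (h : HasType R Γ M A e) (hR : Extends R' R)
    {σ : ℕ → Tm Reg}
    (hσ : ∀ (x : ℕ) (B : Ty Reg), Γ[x]? = some B → (R', σ x) ∈ sem R B ∅) :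
    (R', M.subst σ) ∈ sem R A e := by
  have htyp : ∀ {Δ N B e'} {σ : ℕ → Tm Reg} {R' : RCtx Reg}, Extends R' R →
      HasType R Δ N B e' → (∀ (x : ℕ) (B : Ty Reg), Δ[x]? = some B → (R', σ x) ∈ sem R B ∅) →
      HasType R' [] (N.subst σ) B e' := fun hR h hσ =>
    (h.mono hR).subst (.nil hR.1) fun x B hx => (hσ x B hx).1.2
  induction h generalizing R' σ with
  | var hΓ hx => exact hσ _ _ hx
  | @reg Γ r A hΓ hr =>
    exact mem_sem_of_isValue (.reg r) hR (.reg (.nil hR.1) (hR.mem hr)) rfl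
  | star hΓ => exact mem_sem_of_isValue .star hR (.star (.nil hR.1)) rfl
  | @lam Γ M A B e h ih =>
    have ht : HasType R' [] (.lam (M.subst (upSubst σ))) _ ∅ := htyp hR (HasType.lam h) hσ
    refine mem_sem_of_isValue (.lam _) hR ht ⟨⟨_, rfl⟩, fun R₁ V hR₁ hV => ?_⟩
    have hR₁' := hR₁.trans hR
    have hbody : (R₁, (M.subst (upSubst σ)).inst V.1) ∈ sem R B e := by
      rw [Tm.subst_upSubst_inst]
      refine ih hR₁' fun x C hx => ?_
      cases x with
      | zero =>
        obtain rfl : A = C := by simpa using hx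
        exact hV
      | succ x => exact sem_mono hR₁ (hσ x C (by simpa using hx))
    exact app_lam_mem_sem V.2 (by simpa using HasType.app (ht.mono hR₁) hV.1.2) hbody
  | @app Γ M N A B e₁ e₂ e₃ h₁ h₂ ih₁ ih₂ =>
    refine mem_sem_iff_safe.2 ⟨hR, htyp hR (.app h₁ h₂) hσ, fun R₂ hR₂ => ?_⟩
    refine (safe_mem_sem (sem_mono hR₂ (ih₁ hR hσ)) h₁.wf.2).bind
      (isFrame_appL (N.subst σ)) (fun V hV => hV.1) fun F hF => ?_
    refine (safe_mem_sem (sem_mono hR₂ (ih₂ hR hσ)) h₂.wf.2).bind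
      (isFrame_appR hF.1) (fun V hV => hV.1) fun V hV => ?_
    have happ := (cPred_of_mem_sem hF.1 hF.2).2 R₂ ⟨V, hV.1⟩ (.refl hR₂.1) hV.2
    exact (reducible_iff.1 happ).2.2 R₂ (.refl hR₂.1)
  | @get Γ M r A e h ih =>
    refine mem_sem_iff_safe.2 ⟨hR, htyp hR (.get h) hσ, fun R₂ hR₂ => ?_⟩
    refine (safe_mem_sem (sem_mono hR₂ (ih hR hσ)) h.wf.2).bind isFrame_get
      (fun V hV => hV.1) fun K hK => ?_
    obtain rfl : K = .reg r := cPred_of_mem_sem hK.1 hK.2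
    have hr : (r, A) ∈ R := by
      cases h.wf.1
      assumption
    have hstep : ∀ a N, LStep (.get (.reg r)) a N → ∃ V, a = .read r V ∧ N = V.1 := by
      intro a N hs
      cases hs with
      | read _ V => exact ⟨V, rfl, rfl⟩
      | get hs => cases hs
    have hR₂' := hR₂.trans hR
    refine .intro (fun a N hs _ => ?_) (fun a N hs ha => ?_) fun hn => ?_
    · obtain ⟨V, rfl, -⟩ := hstep a N hs
      rfl
    · obtain ⟨V, rfl, rfl⟩ := hstep a N hs
      exact .of_isValue V.2 (cPred_of_mem_sem V.2 ((mem_satStore_iff hR₂' hr).1 ha))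
    · let V : Val Reg := ⟨A.inhabitant, A.inhabitant_isValue⟩
      exact absurd ((mem_satStore_iff (V := V) hR₂' hr).2
        ((Ty.WF.rctx h.wf.1).wf_of_mem hr |>.inhabitant_mem_sem hR₂')) (hn _ _ (.read r V))
  | @set Γ M N r A e₁ e₂ h₁ h₂ ih₁ ih₂ =>
    refine mem_sem_iff_safe.2 ⟨hR, htyp hR (.set h₁ h₂) hσ, fun R₂ hR₂ => ?_⟩
    refine (safe_mem_sem (sem_mono hR₂ (ih₁ hR hσ)) h₁.wf.2).bind
      (isFrame_setL (N.subst σ)) (fun V hV => hV.1) fun K hK => ?_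
    obtain rfl : K = .reg r := cPred_of_mem_sem hK.1 hK.2
    refine (safe_mem_sem (sem_mono hR₂ (ih₂ hR hσ)) h₂.wf.2).bind
      (isFrame_setR (.reg r)) (fun V hV => hV.1) fun V hV => ?_
    have hr : (r, A) ∈ R := by
      cases h₁.wf.1
      assumption
    have hmem := (mem_satStore_iff (V := ⟨V, hV.1⟩) (hR₂.trans hR) hr).2 hV.2
    have hstep : ∀ a N, LStep (.set (.reg r) V) a N → a = .write r ⟨V, hV.1⟩ ∧ N = .star := by
      intro a N hs
      cases hs with
      | write => exact ⟨rfl, rfl⟩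
      | setL _ hs => cases hs
      | setR _ hs => exact absurd hs hV.1.not_lStep
    refine .intro (fun a K hs _ => ?_) (fun a K hs _ => ?_) fun hn => ?_
    · rw [(hstep a K hs).1]; exact Store.union_cell_eq_self.2 hmem
    · rw [(hstep a K hs).2]; exact .of_isValue .star rfl
    · exact absurd trivial (hn _ _ (.write r hV.1))
  | sub _ hs ih =>
    exact reducible_sub hs (fun R'' N h'' hN => hN.sub hs.1 h'') (ih hR hσ)

theorem HasType.mem_sem (h : HasType R [] M A e) : (R, M) ∈ sem R A e := by
  rw [← M.subst_var]
  exact h.subst_mem_sem (.refl h.ctxWF.1) (by simp)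

theorem ProgHasType.exists_hasType {P : Prog Reg} {Γ : List (Ty Reg)} (h : ProgHasType R Γ P e)
    (hM : M ∈ P.threads) : ∃ A e, HasType R Γ M A e := by
  induction h with
  | thread h =>
    obtain rfl := Multiset.mem_singleton.1 hM
    exact ⟨_, _, h⟩
  | cell => exact absurd hM (Multiset.notMem_zero M)
  | par _ _ ih₁ ih₂ => exact (Multiset.mem_add.1 hM).elim ih₁ ih₂

end Reducibility

end RegionCalculus

theorem mainTheorem2 {Reg : Type*} [DecidableEq Reg] (R : RCtx Reg) :
    (∀ (M : Tm Reg) (A : Ty Reg) (e : Finset Reg),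
      HasType R [] M A e ↔ (R, M) ∈ sem R A e) ∧
    (∀ (Ms : Multiset (Tm Reg)) (e : Finset Reg),
      ProgHasType R [] (Prog.ofThreads Ms) e → Terminates (Prog.ofThreads Ms)) := by
  refine ⟨fun M A e => ⟨HasType.mem_sem, fun h => h.1.2⟩, fun Ms e h => ?_⟩
  refine terminates_of_safe (S := satStore R R) (C := fun _ => True) (fun M hM => ?_)
    fun r => Set.empty_subset _
  obtain ⟨A, e', ht⟩ := h.exists_hasType hM
  exact ((mem_sem_iff_safe.1 ht.mem_sem).2.2 R (.refl ht.ctxWF.1)).imp fun _ _ => trivial
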